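/- Write $X^{[k]}$ for the set of families $(x_\epsilon)_{\epsilon\in\{0,1\}^k}$ of points of $X$; faces of $\mathbf x\in X^{[3]}$ are regarded as elements of $X^{[2]}$ (vertices in lexicographic order), and $X^{[3]}=X^{[2]}\times X^{[2]}$. A \emph{parallelogram structure} on a nonempty set $X$ is a set $P\subset X^{[2]}$ such that (i) $(x_{00},x_{01})\sim(x_{10},x_{11})\iff(x_{00},x_{01},x_{10},x_{11})\in P$ defines an equivalence relation on $X^2$; (ii) $(x_{00},x_{01},x_{10},x_{11})\in P$ implies $(x_{00},x_{10},x_{01},x_{11})\in P$; (iii) for all $x_{00},x_{01},x_{10}\in X$ there is $x_{11}\in X$ with $(x_{00},x_{01},x_{10},x_{11})\in P$. Write $\overline{x,y}$ for the $\sim$-class of $(x,y)$. The \emph{base group} is $B=X^2/\!\sim$, an abelian group for the multiplication with $\overline{a,b}\cdot\overline{b,c}=\overline{a,c}$. A \emph{parallelepiped structure} $(P,Q)$ on $X$ consists of a parallelogram structure $P$ and a set $Q\subset X^{[3]}$ such that every face of every element of $Q$ is in $P$; $Q$ is invariant under the permutations of coordinates induced by the Euclidean isometries of the cube; $\mathbf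 x'\approx\mathbf x''\iff(\mathbf x',\mathbf x'')\in Q$ defines an equivalence relation on $P$; and whenever seven points $x_{000},\dots,x_{110}$ are such that the three faces containing $000$ are in $P$, there is $x_{111}\in X$ with $(x_{000},\dots,x_{111})\in Q$. It is \emph{strong} if this $x_{111}$ is always unique. For $s\in B$ let $P_s$ be the set of $\approx$-classes $\langle\mathbf x\rangle$ of those $\mathbf x\in P$ with $\overline{x_{00},x_{01}}=s$; it is an abelian group for the multiplication with $\langle x_0,x_1,x_2,x_3\rangle\langle x_2,x_3,x_4,x_5\rangle=\langle x_0,x_1,x_4,x_5\rangle$, and $q_s\colon P_s\to B$, $\langle\mathbf x\rangle\mapsto\overline{x_{00},x_{10}}$, is a homomorphism. The \emph{fiber group} is $\ker(q_1\colon P_1\to B)$. For a group $G$, let $G^{[3,2]}\le G^{[3]}$ be the subgroup generated by the elements equal to some $g\in G$ on a face of the cube and to $1$ elsewhere, and for $H\le G$ let $H^{[k,1]}\le G^{[k]}$ be the subgroup generated by the elements equal to some $h\in H$ on an edge of $\{0,1\}^k$ and to $1$ elsewhere. A parallelepiped structure $(P,Q)$ on $X$ is a \emph{nilparallelepiped structure}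 if there are a group $G$, subgroups $F,\Gamma\le G$ with $[G,G]\subset F\subset Z(G)$ and $\Gamma\cap F=\{1\}$, and a bijection of $X$ onto $G/\Gamma$ that carries $P$ and $Q$ to the images of $G^{[2,1]}F^{[2]}$ and $G^{[3,2]}F^{[3,1]}$ in $(G/\Gamma)^{[2]}$ and $(G/\Gamma)^{[3]}$. \textbf{Corollary.} Let $(P,Q)$ be a strong parallelepiped structure on a nonempty set $X$. If its fiber group is an injective abelian group (that is, injective as a $\mathbb Z$-module; equivalently, divisible) or its base group is a projective abelian group (that is, projective as a $\mathbb Z$-module; equivalently, free), then $(P,Q)$ is a nilparallelepiped structure. -/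

import Mathlib

universe u

/-- Points of `X^[k]`: families `x_ε` of points of `X` indexed by the vertices `ε ∈ {0,1}^k` of the
unit cube (`false` is `0`, `true` is `1`; the first digit of `ε = ε₁…ε_k` is `ε 0`). -/
abbrev Cube (k : ℕ) (X : Type u) : Type u := (Fin k → Bool) → X

namespace Cube

variable {X : Type u}

/-- The point `(x₀₀, x₀₁, x₁₀, x₁₁)` of `X^[2]`. -/
def sq (x₀₀ x₀₁ x₁₀ x₁₁ : X) : Cube 2 X := fun ε =>
  bif ε 0 then (bif ε 1 then x₁₁ else x₁₀) else (bif ε 1 then x₀₁ else x₀₀)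

/-- The point `(x', x'')` of `X^[k+1]`, under the identification `X^[k+1] = X^[k] × X^[k]`. -/
def glue {k : ℕ} (x' x'' : Cube k X) : Cube (k + 1) X := fun ε =>
  bif ε 0 then x'' (Fin.tail ε) else x' (Fin.tail ε)

/-- The face of `x` over `{ε | ε j = c}`, seen as a point of `X^[k]` by listing its vertices in
increasing lexicographic order. -/
def face {k : ℕ} (j : Fin (k + 1)) (c : Bool) (x : Cube (k + 1) X) : Cube k X :=
  fun ε => x (Fin.insertNth (α := fun _ => Bool) j c ε)

/-- The identification of `(X × X)^[k]` with `X^[k+1]`: the pair at the vertex `ε` gives the points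
at the vertices `ε0` and `ε1`. -/
def unpair {k : ℕ} (y : Cube k (X × X)) : Cube (k + 1) X := fun ε =>
  bif ε (Fin.last k) then (y (Fin.init ε)).2 else (y (Fin.init ε)).1

/-- The permutations of the vertices of the unit cube that come from Euclidean isometries of the
cube, that is, those that preserve distances between vertices (the Euclidean distance of two
vertices is the square root of their Hamming distance). -/
def IsEuclidean {k : ℕ} (σ : Equiv.Perm (Fin k → Bool)) : Prop :=
  ∀ ε η : Fin k → Bool, hammingDist (σ ε) (σ η) = hammingDist ε η

theorem ext₂ {x y : Cube 2 X} (h : ∀ a b, x ![a, b] = y ![a, b]) : x = y := by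
  funext ε
  have : ε = ![ε 0, ε 1] := by funext i; fin_cases i <;> rfl
  rw [this]
  exact h _ _

theorem ext₃ {x y : Cube 3 X} (h : ∀ a b c, x ![a, b, c] = y ![a, b, c]) : x = y := by
  funext ε
  have : ε = ![ε 0, ε 1, ε 2] := by funext i; fin_cases i <;> rfl
  rw [this]
  exact h _ _ _

theorem unpair_sq (p q r s : X × X) :
    unpair (sq p q r s) = glue (sq p.1 p.2 q.1 q.2) (sq r.1 r.2 s.1 s.2) :=
  ext₃ (by rintro (_ | _) (_ | _) (_ | _) <;> rfl)

theorem face₀_glue (x y : Cube 2 X) : face 0 false (glue x y) = x :=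
  ext₂ (by rintro (_ | _) (_ | _) <;> exact congrArg x (by decide))

theorem face₀_true_glue (x y : Cube 2 X) : face 0 true (glue x y) = y :=
  ext₂ (by rintro (_ | _) (_ | _) <;> exact congrArg y (by decide))

theorem face₂_glue (p q r s : X × X) :
    face 2 false (glue (sq p.1 p.2 q.1 q.2) (sq r.1 r.2 s.1 s.2)) = sq p.1 q.1 r.1 s.1 :=
  ext₂ (by rintro (_ | _) (_ | _) <;> rfl)

theorem face₁_glue (p q r s : X × X) :
    face 1 false (glue (sq p.1 p.2 q.1 q.2) (sq r.1 r.2 s.1 s.2)) = sq p.1 p.2 r.1 r.2 :=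
  ext₂ (by rintro (_ | _) (_ | _) <;> rfl)

/-- The exchange of the first two coordinates of the unit cube. -/
def exchange : Equiv.Perm (Fin 3 → Bool) := Equiv.arrowCongr (Equiv.swap 0 1) (Equiv.refl Bool)

theorem isEuclidean_exchange : IsEuclidean exchange := by
  unfold IsEuclidean
  decide

theorem unpair_sq_exchange (p q r s : X × X) :
    unpair (sq p q r s) ∘ exchange = unpair (sq p r q s) :=
  ext₃ (by rintro (_ | _) (_ | _) (_ | _) <;> rfl)

theorem update_glue (x : Cube 2 X) (a b c d e : X) :
    Function.update (glue x (sq a b c d)) (fun _ => true) e = glue x (sq a b c e) :=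
  ext₃ (by
    rintro (_ | _) (_ | _) (_ | _)
    all_goals first
      | exact Function.update_of_ne (by decide) _ _
      | exact (congrArg _ (by decide : ![true, true, true] = fun _ => true)).trans
          (Function.update_self _ _ _))

end Cube

open Cube in
/-- A (weak) parallelogram structure on a nonempty set `X`. -/
structure ParallelogramStructure (X : Type u) where
  nonempty : Nonempty X
  /-- the set of parallelograms -/
  P : Set (Cube 2 X)
  equivalence : Equivalence (fun p q : X × X => sq p.1 p.2 q.1 q.2 ∈ P)
  symmetry : ∀ x₀₀ x₀₁ x₁₀ x₁₁ : X, sq x₀₀ x₀₁ x₁₀ x₁₁ ∈ P → sq x₀₀ x₁₀ x₀₁ x₁₁ ∈ P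
  closing : ∀ x₀₀ x₀₁ x₁₀ : X, ∃ x₁₁ : X, sq x₀₀ x₀₁ x₁₀ x₁₁ ∈ P

namespace ParallelogramStructure

open Cube

variable {X : Type u} (S : ParallelogramStructure X)

/-- The equivalence relation `∼` on `X × X`. -/
def setoid : Setoid (X × X) := ⟨fun p q => sq p.1 p.2 q.1 q.2 ∈ S.P, S.equivalence⟩

/-- The base `B = (X × X)/∼`. -/
def Base : Type u := Quotient S.setoid

/-- The class of the pair `(x, y)` in the base. -/
def cls (x y : X) : S.Base := Quotient.mk S.setoid (x, y)

theorem cls_eq_cls {a b c d : X} : S.cls a b = S.cls c d ↔ sq a b c d ∈ S.P :=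
  Quotient.eq (r := S.setoid)

theorem cls_swap {a b c d : X} : S.cls a b = S.cls c d ↔ S.cls a c = S.cls b d := by
  simp only [cls_eq_cls]
  exact ⟨S.symmetry _ _ _ _, S.symmetry _ _ _ _⟩

theorem exists_cls_eq (s : S.Base) (a : X) : ∃ b : X, S.cls a b = s := by
  induction s using Quotient.inductionOn with
  | h p =>
    obtain ⟨b, hb⟩ := S.closing p.1 p.2 a
    exact ⟨b, ((S.cls_eq_cls).2 hb).symm⟩

/-- The multiplication of `B`, characterised by `cls_mul_cls`. -/
noncomputable def mul (s t : S.Base) : S.Base :=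
  Quotient.liftOn₂ s t (fun p q => S.cls p.1 (S.exists_cls_eq (S.cls q.1 q.2) p.2).choose) <| by
    rintro ⟨a, b⟩ ⟨c, d⟩ ⟨a', b'⟩ ⟨c', d'⟩ h₁ h₂
    have h₁ : S.cls a b = S.cls a' b' := Quotient.sound (s := S.setoid) h₁
    have h₂ : S.cls c d = S.cls c' d' := Quotient.sound (s := S.setoid) h₂
    have he := (S.exists_cls_eq (S.cls c d) b).choose_spec
    have he' := (S.exists_cls_eq (S.cls c' d') b').choose_spec
    have h₃ := S.cls_swap.1 (he.trans (h₂.trans he'.symm))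
    exact S.cls_swap.2 ((S.cls_swap.1 h₁).trans h₃)

noncomputable instance : Mul S.Base := ⟨S.mul⟩

/-- The defining property of the multiplication of `B`. -/
theorem cls_mul_cls (a b c : X) : S.cls a b * S.cls b c = S.cls a c := by
  change S.cls a (S.exists_cls_eq (S.cls b c) b).choose = S.cls a c
  have he := S.cls_swap.1 (S.exists_cls_eq (S.cls b c) b).choose_spec
  exact S.cls_swap.2 ((S.cls_swap.1 (rfl : S.cls a b = S.cls a b)).trans he)

theorem cls_self (a b : X) : S.cls a a = S.cls b b :=
  S.cls_swap.2 rfl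

/-- The base group: the abelian group structure on `B`. The unit is the common class of the pairs
`(x, x)`, and the inverse of the class of `(x, y)` is the class of `(y, x)`. -/
noncomputable instance : CommGroup S.Base where
  mul_assoc s t w := by
    obtain ⟨a⟩ := S.nonempty
    obtain ⟨b, rfl⟩ := S.exists_cls_eq s a
    obtain ⟨c, rfl⟩ := S.exists_cls_eq t b
    obtain ⟨d, rfl⟩ := S.exists_cls_eq w c
    simp only [cls_mul_cls]
  one := S.cls S.nonempty.some S.nonempty.some
  one_mul s := by
    obtain ⟨b, rfl⟩ := S.exists_cls_eq s S.nonempty.some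
    exact S.cls_mul_cls _ _ _
  mul_one s := by
    obtain ⟨b, rfl⟩ := S.exists_cls_eq s S.nonempty.some
    change S.cls _ b * S.cls _ _ = _
    rw [S.cls_self _ b, cls_mul_cls]
  inv s := Quotient.liftOn s (fun p => S.cls p.2 p.1) <| by
    rintro ⟨a, b⟩ ⟨a', b'⟩ h
    have h : S.cls a b = S.cls a' b' := Quotient.sound (s := S.setoid) h
    exact S.cls_swap.2 (S.cls_swap.1 h).symm
  inv_mul_cancel s := by
    obtain ⟨b, rfl⟩ := S.exists_cls_eq s S.nonempty.some
    change S.cls b _ * S.cls _ b = S.cls _ _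
    rw [cls_mul_cls]
    exact S.cls_self _ _
  mul_comm s t := by
    obtain ⟨a⟩ := S.nonempty
    obtain ⟨b, rfl⟩ := S.exists_cls_eq s a
    obtain ⟨d, rfl⟩ := S.exists_cls_eq t a
    obtain ⟨c, hc⟩ := S.exists_cls_eq (S.cls a d) b
    have h := S.cls_swap.1 hc.symm
    rw [← hc, cls_mul_cls, hc, h, cls_mul_cls]

theorem one_eq_cls (a : X) : (1 : S.Base) = S.cls a a := S.cls_self _ a

end ParallelogramStructure

open Cube in
/-- A (weak) parallelepiped structure `(P, Q)` on a nonempty set `X`. In `closing`, the value of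
`x` at the vertex `111` plays no role. -/
structure ParallelepipedStructure (X : Type u) extends ParallelogramStructure X where
  /-- the set of parallelepipeds -/
  Q : Set (Cube 3 X)
  face_mem : ∀ x ∈ Q, ∀ (j : Fin 3) (c : Bool), face j c x ∈ P
  euclidean : ∀ σ : Equiv.Perm (Fin 3 → Bool), IsEuclidean σ → ∀ x ∈ Q, x ∘ σ ∈ Q
  equivalence₃ : Equivalence (fun x' x'' : P => glue (x' : Cube 2 X) (x'' : Cube 2 X) ∈ Q)
  closing₃ : ∀ x : Cube 3 X, (∀ j : Fin 3, face j false x ∈ P) →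
    ∃ x₁₁₁ : X, Function.update x (fun _ => true) x₁₁₁ ∈ Q

namespace ParallelepipedStructure

open Cube

variable {X : Type u} (S : ParallelepipedStructure X)

/-- The structure is strong: the last point in the closing parallelepiped property is unique. -/
def IsStrong : Prop :=
  ∀ x : Cube 3 X, (∀ j : Fin 3, face j false x ∈ S.P) → ∀ y z : X,
    Function.update x (fun _ => true) y ∈ S.Q → Function.update x (fun _ => true) z ∈ S.Q → y = z

/-- The set `X_s` of the pairs of class `s`. -/
abbrev Pairs (s : S.Base) : Type u := {p : X × X // S.cls p.1 p.2 = s}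

theorem sq_val {s : S.Base} (p q r t : S.Pairs s) :
    (fun ε => (sq p q r t ε).1) = sq p.1 q.1 r.1 t.1 :=
  ext₂ (by rintro (_ | _) (_ | _) <;> rfl)

/-- The parallelogram structure `Q_s` on `X_s`: a quadruple of pairs of class `s` is a
parallelogram when the eight points form a parallelepiped. -/
def pairStructure (s : S.Base) : ParallelogramStructure (S.Pairs s) where
  nonempty := by
    obtain ⟨a⟩ := S.nonempty
    obtain ⟨b, hb⟩ := S.exists_cls_eq s a
    exact ⟨⟨(a, b), hb⟩⟩
  P := {y | unpair (fun ε => (y ε).1) ∈ S.Q}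
  equivalence := by
    have key : ∀ p q r t : S.Pairs s, unpair (fun ε => (sq p q r t ε).1) ∈ S.Q ↔
        glue (sq p.1.1 p.1.2 q.1.1 q.1.2) (sq r.1.1 r.1.2 t.1.1 t.1.2) ∈ S.Q := by
      intro p q r t
      rw [sq_val, unpair_sq]
    have hP : ∀ p : S.Pairs s × S.Pairs s,
        sq p.1.1.1 p.1.1.2 p.2.1.1 p.2.1.2 ∈ S.P := fun p =>
      (S.cls_eq_cls).1 (p.1.2.trans p.2.2.symm)
    refine ⟨fun p => ?_, fun {p r} h => ?_, fun {p r t} h h' => ?_⟩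
    · exact (key _ _ _ _).2 (S.equivalence₃.refl ⟨_, hP p⟩)
    · exact (key _ _ _ _).2
        (S.equivalence₃.symm (x := ⟨_, hP p⟩) (y := ⟨_, hP r⟩) ((key _ _ _ _).1 h))
    · exact (key _ _ _ _).2
        (S.equivalence₃.trans (x := ⟨_, hP p⟩) (y := ⟨_, hP r⟩) (z := ⟨_, hP t⟩)
          ((key _ _ _ _).1 h) ((key _ _ _ _).1 h'))
  symmetry p q r t h := by
    change unpair _ ∈ S.Q at h ⊢
    rw [sq_val] at h ⊢
    rw [← unpair_sq_exchange]
    exact S.euclidean _ isEuclidean_exchange _ h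
  closing p q r := by
    obtain ⟨x, hx⟩ := S.closing p.1.1 q.1.1 r.1.1
    obtain ⟨y, hy⟩ := S.closing₃
      (glue (sq p.1.1 p.1.2 q.1.1 q.1.2) (sq r.1.1 r.1.2 x x)) (by
        intro j
        fin_cases j
        · exact (face₀_glue _ _).symm ▸ (S.cls_eq_cls).1 (p.2.trans q.2.symm)
        · exact (face₁_glue p.1 q.1 r.1 (x, x)).symm ▸ (S.cls_eq_cls).1 (p.2.trans r.2.symm)
        · exact (face₂_glue p.1 q.1 r.1 (x, x)).symm ▸ hx)
    rw [update_glue] at hy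
    have hf := S.face_mem _ hy 0 true
    rw [face₀_true_glue] at hf
    refine ⟨⟨(x, y), ((S.cls_eq_cls).2 hf).symm.trans r.2⟩, ?_⟩
    change unpair _ ∈ S.Q
    rw [sq_val, unpair_sq]
    exact hy

theorem pair_cls_eq {s : S.Base} {p q r t : S.Pairs s} :
    (S.pairStructure s).cls p q = (S.pairStructure s).cls r t ↔
      glue (sq p.1.1 p.1.2 q.1.1 q.1.2) (sq r.1.1 r.1.2 t.1.1 t.1.2) ∈ S.Q := by
  rw [ParallelogramStructure.cls_eq_cls]
  change unpair _ ∈ S.Q ↔ _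
  rw [sq_val, unpair_sq]

/-- The abelian group `P_s`: the set `(X_s × X_s)/∼`, that is, the set of `≈`-classes of
parallelograms `x` with `(x₀₀, x₀₁)` of class `s`, with the multiplication
`⟨x₀, x₁, x₂, x₃⟩ ⟨x₂, x₃, x₄, x₅⟩ = ⟨x₀, x₁, x₄, x₅⟩`. -/
abbrev PGroup (s : S.Base) : Type u := (S.pairStructure s).Base

/-- The homomorphism `q_s : P_s → B` sending the class of a parallelogram `x` to the class of
`(x₀₀, x₁₀)`. -/
noncomputable def q (s : S.Base) : S.PGroup s →* S.Base :=
  MonoidHom.mk'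
    (fun w => Quotient.liftOn w (fun p => S.cls p.1.1.1 p.2.1.1) <| by
      rintro ⟨a, b⟩ ⟨c, d⟩ h
      have h : (S.pairStructure s).cls a b = (S.pairStructure s).cls c d :=
        Quotient.sound (s := (S.pairStructure s).setoid) h
      have hf := S.face_mem _ (S.pair_cls_eq.1 h) 2 false
      rw [face₂_glue a.1 b.1 c.1 d.1] at hf
      exact S.cls_eq_cls.2 hf) <| by
    intro v w
    obtain ⟨a⟩ := (S.pairStructure s).nonempty
    obtain ⟨b, rfl⟩ := (S.pairStructure s).exists_cls_eq v a
    obtain ⟨c, rfl⟩ := (S.pairStructure s).exists_cls_eq w b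
    rw [ParallelogramStructure.cls_mul_cls]
    exact (S.cls_mul_cls a.1.1 b.1.1 c.1.1).symm

theorem q_cls {s : S.Base} (a b : S.Pairs s) :
    S.q s ((S.pairStructure s).cls a b) = S.cls a.1.1 b.1.1 := rfl

/-- The fiber group: the kernel of `q₁ : P₁ → B`, that is, the group of `≈`-classes of vertical
parallelograms. -/
abbrev FiberGroup : Type u := (S.q 1).ker

end ParallelepipedStructure

section Nil

open Cube

variable {G : Type u} [Group G]

open Classical in
/-- The element `g^[k,α]` of `G^[k]`: `g` at the vertices in `α` and `1` elsewhere. -/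
noncomputable def Cube.on {k : ℕ} (g : G) (α : Set (Fin k → Bool)) : Cube k G :=
  fun ε => if ε ∈ α then g else 1

/-- The edge of the unit cube through the vertex `η` in the direction `j`. -/
def Cube.edgeSet {k : ℕ} (j : Fin k) (η : Fin k → Bool) : Set (Fin k → Bool) :=
  {ε | ∀ i, i ≠ j → ε i = η i}

/-- The edge group `H^[k,1]` of a subgroup `H` of `G`, as a subgroup of `G^[k]`. -/
noncomputable def edgeGroup (k : ℕ) (H : Subgroup G) : Subgroup (Cube k G) :=
  Subgroup.closure {x | ∃ g ∈ H, ∃ (j : Fin k) (η : Fin k → Bool), x = Cube.on g (edgeSet j η)}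

/-- The face group `G^[3,2]`, spanned by the elements `g^[3,f]` for `g ∈ G` and `f` a face. -/
noncomputable def faceGroup (G : Type u) [Group G] : Subgroup (Cube 3 G) :=
  Subgroup.closure {x | ∃ (g : G) (j : Fin 3) (c : Bool), x = Cube.on g {ε | ε j = c}}

/-- The set `G^[2,1] F^[2]` of parallelograms of `G`. -/
def nilP (F : Subgroup G) : Set (Cube 2 G) :=
  {x | ∃ g ∈ edgeGroup 2 (⊤ : Subgroup G), ∃ f : Cube 2 G, (∀ ε, f ε ∈ F) ∧ x = g * f}

/-- The set `G^[3,2] F^[3,1]` of parallelepipeds of `G`. -/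
def nilQ (F : Subgroup G) : Set (Cube 3 G) :=
  {x | ∃ g ∈ faceGroup G, ∃ f ∈ edgeGroup 3 F, x = g * f}

/-- The map `π^[k]` from `G^[k]` to `(G/Γ)^[k]`. -/
def Cube.proj {k : ℕ} (Γ : Subgroup G) (x : Cube k G) : Cube k (G ⧸ Γ) :=
  fun ε => (QuotientGroup.mk (x ε) : G ⧸ Γ)

/-- The set of parallelograms of the nilmanifold `G/Γ`. -/
def nilPX (F Γ : Subgroup G) : Set (Cube 2 (G ⧸ Γ)) := Cube.proj Γ '' nilP F

/-- The set of parallelepipeds of the nilmanifold `G/Γ`. -/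
def nilQX (F Γ : Subgroup G) : Set (Cube 3 (G ⧸ Γ)) := Cube.proj Γ '' nilQ F

end Nil

/-- `(P, Q)` is a nilparallelepiped structure: `X` can be identified with a coset space `G/Γ`,
where `G₂ ⊆ F ⊆ Z(G)` and `Γ ∩ F = {1}`, in such a way that `P` and `Q` become the images in `G/Γ`
of `G^[2,1] F^[2]` and `G^[3,2] F^[3,1]`. -/
def ParallelepipedStructure.IsNilparallelepiped {X : Type u} (S : ParallelepipedStructure X) :
    Prop :=
  ∃ (G : Type u) (_ : Group G) (F Γ : Subgroup G) (φ : X ≃ G ⧸ Γ),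
    commutator G ≤ F ∧ F ≤ Subgroup.center G ∧ Γ ⊓ F = ⊥ ∧
    (∀ x : Cube 2 X, x ∈ S.P ↔ φ ∘ x ∈ nilPX F Γ) ∧
    (∀ x : Cube 3 X, x ∈ S.Q ↔ φ ∘ x ∈ nilQX F Γ)

/-!
The group that turns `X` into a coset space is the group `G` of the permutations of `X` that
preserve `Q` when applied to the vertices of a face of the cube, and its central subgroup `F`
consists of those that preserve `Q` when applied to the vertices of an edge. Two faces can meet in
an edge, so `[G, G] ⊆ F` (`commutator_mem_edgeTranslations`). An edge and a face can meet in a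
vertex, and by uniqueness of the last vertex only the identity preserves `Q` when applied to a
single vertex, so `F` is central (`edge_commute`). By the same uniqueness `F` acts freely
(`edge_eq_one`), so it meets the stabilizer `Γ` of a point trivially.

Let `s ∈ B`, let `(a, b)` be a pair of class `s` and let `σ : B → P_s` be a homomorphic section of
`q_s`. For each `x` there is exactly one `y` for which `⟨a, b, x, y⟩` is the value of `σ` at the
class of `(a, x)`. The map `x ↦ y` is a permutation `g` with `g a = b`, and `⟨x, g x, y, g y⟩` is
the value of `σ` at the class of `(x, y)`. Hence every parallelogram is equivalent under `≈` to its
image by `g`, that is, `g ∈ G` (`exists_faceTranslation`). For `s = 1` the diagonal section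
`⟨x, x, y, y⟩` is available, and it produces elements of `F`; therefore `F` acts simply transitively
on the classes of the relation `S.cls a b = 1` (`exists_edgeTranslation`).

Consequently `u ↦ ⟨a, b, a, u b⟩` is an isomorphism of `F` onto `ker q_s` for every `s`, so all
these kernels are isomorphic to the fiber group (`nonempty_edgeTranslations_mulEquiv`). If the fiber
group is injective, or the base group projective, every `q_s` has a section (`exists_section`), and
`G` acts transitively on `X`.

Finally, identify `X` with `G/Γ`. Elements of `G^[2,1] F^[2]` and `G^[3,2] F^[3,1]` send constant
families to parallelograms and parallelepipeds. Conversely, every parallelogram and parallelepiped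
is reached from a constant family: transitivity of `G` gives the vertices adjacent to the origin,
`F` corrects the others, and the last vertex of a parallelepiped is right by uniqueness
(`exists_nilP_of_mem_P`, `exists_nilQ_of_mem_Q`).
-/

open Function Cube

/-! ### Isometries of the cube -/

namespace Cube

variable {k : ℕ}

/-- The isometry of the unit cube that permutes the coordinates by `τ` and then reflects those
coordinates `i` for which `c i` is `1`. -/
def isometry (τ : Equiv.Perm (Fin k)) (c : Fin k → Bool) : Equiv.Perm (Fin k → Bool) where
  toFun ε i := xor (ε (τ i)) (c i)
  invFun ε i := xor (ε (τ.symm i)) (c (τ.symm i))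
  left_inv ε := by funext i; simp
  right_inv ε := by funext i; simp

theorem isometry_apply (τ : Equiv.Perm (Fin k)) (c ε : Fin k → Bool) (i : Fin k) :
    isometry τ c ε i = xor (ε (τ i)) (c i) := rfl

theorem isEuclidean_isometry (τ : Equiv.Perm (Fin k)) (c : Fin k → Bool) :
    IsEuclidean (isometry τ c) := by
  intro ε η
  have h₁ := hammingDist_comp (fun i b => xor b (c i)) (x := ε ∘ τ) (y := η ∘ τ)
    (fun i a b h => by simpa using h)
  refine h₁.trans ?_
  simp only [hammingDist]
  exact Finset.card_equiv τ (by simp)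

theorem IsEuclidean.symm {σ : Equiv.Perm (Fin k → Bool)} (h : IsEuclidean σ) :
    IsEuclidean σ.symm := fun ε η => by
  simpa using (h (σ.symm ε) (σ.symm η)).symm

/-- Every face is the inverse image of the face `{ε | ε 0 = 0}` under an isometry. -/
theorem preimage_isometry_face (j : Fin (k + 1)) (c : Bool) :
    isometry (Equiv.swap 0 j) (fun _ => c) ⁻¹' {ε | ε 0 = false} = {ε | ε j = c} := by
  ext ε
  simp [isometry_apply]

/-- Every edge is the inverse image of the edge through `0` in direction `0` under an isometry. -/
theorem preimage_isometry_edgeSet (j : Fin (k + 1)) (η : Fin (k + 1) → Bool) :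
    isometry (Equiv.swap 0 j) (η ∘ Equiv.swap 0 j) ⁻¹' edgeSet 0 (fun _ => false)
      = edgeSet j η := by
  ext ε
  simp only [edgeSet, Set.mem_preimage, Set.mem_ofPred_eq, isometry_apply, comp_apply,
    bne_eq_false_iff_eq]
  refine (Equiv.swap 0 j).forall_congr fun {i} => ?_
  rw [Ne, Ne, ← Equiv.eq_symm_apply, Equiv.symm_swap, Equiv.swap_apply_right]

variable {G : Type*} [Group G]

theorem on_apply (g : G) (α : Set (Fin k → Bool)) (ε : Fin k → Bool) [Decidable (ε ∈ α)] :
    Cube.on g α ε = if ε ∈ α then g else 1 := by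
  unfold Cube.on; congr

theorem on_comp (g : G) (α : Set (Fin k → Bool)) (σ : (Fin k → Bool) → Fin k → Bool) :
    Cube.on g α ∘ σ = Cube.on g (σ ⁻¹' α) := rfl

/-- `g ↦ g^[k,α]` as a homomorphism. -/
noncomputable def onHom (G : Type u) [Group G] (α : Set (Fin k → Bool)) : G →* Cube k G where
  toFun g := Cube.on g α
  map_one' := by classical funext ε; simp [on_apply]
  map_mul' g h := by classical funext ε; by_cases hε : ε ∈ α <;> simp [on_apply, hε]

theorem onHom_apply (g : G) (α : Set (Fin k → Bool)) : onHom G α g = Cube.on g α := rfl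

theorem map_on {H : Type*} [Group H] (f : G →* H) (g : G) (α : Set (Fin k → Bool)) :
    (fun ε => f (Cube.on g α ε)) = Cube.on (f g) α := by
  classical funext ε; by_cases hε : ε ∈ α <;> simp [on_apply, hε]

open scoped commutatorElement in
theorem commutatorElement_on (g h : G) (α β : Set (Fin k → Bool)) :
    ⁅Cube.on g α, Cube.on h β⁆ = Cube.on ⁅g, h⁆ (α ∩ β) := by
  classical
  funext ε
  by_cases hα : ε ∈ α <;> by_cases hβ : ε ∈ β <;>
    simp [commutatorElement_def, on_apply, hα, hβ]

end Cube

/-! ### Calculus of parallelepipeds -/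

namespace ParallelepipedStructure

variable {X : Type u} (S : ParallelepipedStructure X)

/-- The eight points, listed in lexicographic order, form a parallelepiped. -/
def Box (a b c d a' b' c' d' : X) : Prop := glue (sq a b c d) (sq a' b' c' d') ∈ S.Q

variable {S} {a b c d a' b' c' d' a'' b'' c'' d'' : X}

theorem box_refl (h : S.cls a b = S.cls c d) : S.Box a b c d a b c d :=
  S.equivalence₃.refl ⟨_, S.cls_eq_cls.1 h⟩

theorem Box.cls_eq (h : S.Box a b c d a' b' c' d') : S.cls a b = S.cls c d :=
  S.cls_eq_cls.2 (face₀_glue (sq a b c d) _ ▸ S.face_mem _ h 0 false)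

theorem Box.cls_eq' (h : S.Box a b c d a' b' c' d') : S.cls a' b' = S.cls c' d' :=
  S.cls_eq_cls.2 (face₀_true_glue (sq a b c d) (sq a' b' c' d') ▸ S.face_mem _ h 0 true)

theorem Box.symm (h : S.Box a b c d a' b' c' d') : S.Box a' b' c' d' a b c d :=
  S.equivalence₃.symm (x := ⟨_, S.cls_eq_cls.1 h.cls_eq⟩) (y := ⟨_, S.cls_eq_cls.1 h.cls_eq'⟩) h

theorem Box.trans (h : S.Box a b c d a' b' c' d') (h' : S.Box a' b' c' d' a'' b'' c'' d'') :
    S.Box a b c d a'' b'' c'' d'' :=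
  S.equivalence₃.trans (x := ⟨_, S.cls_eq_cls.1 h.cls_eq⟩) (y := ⟨_, S.cls_eq_cls.1 h.cls_eq'⟩)
    (z := ⟨_, S.cls_eq_cls.1 h'.cls_eq'⟩) h h'

theorem mem_Q_comp_iff {σ : Equiv.Perm (Fin 3 → Bool)} (hσ : IsEuclidean σ) {x : Cube 3 X} :
    x ∘ σ ∈ S.Q ↔ x ∈ S.Q := by
  refine ⟨fun h => ?_, S.euclidean σ hσ x⟩
  have := S.euclidean _ hσ.symm _ h
  rwa [comp_assoc, Equiv.self_comp_symm, comp_id] at this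

theorem Box.exchange (h : S.Box a b c d a' b' c' d') : S.Box a b a' b' c d c' d' := by
  have := S.euclidean _ (isEuclidean_isometry (Equiv.swap 0 1) fun _ => false) _ h
  exact Eq.mp (congrArg (· ∈ S.Q) (ext₃ (by rintro (_ | _) (_ | _) (_ | _) <;> rfl))) this

theorem Box.transpose (h : S.Box a b c d a' b' c' d') : S.Box a c b d a' c' b' d' := by
  have := S.euclidean _ (isEuclidean_isometry (Equiv.swap 1 2) fun _ => false) _ h
  exact Eq.mp (congrArg (· ∈ S.Q) (ext₃ (by rintro (_ | _) (_ | _) (_ | _) <;> rfl))) this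

theorem Box.reflect (h : S.Box a b c d a' b' c' d') : S.Box b a d c b' a' d' c' := by
  have := S.euclidean _ (isEuclidean_isometry 1 ![false, false, true]) _ h
  exact Eq.mp (congrArg (· ∈ S.Q) (ext₃ (by rintro (_ | _) (_ | _) (_ | _) <;> rfl))) this

theorem face_false_mem (h₀ : S.cls a b = S.cls c d) (h₁ : S.cls a b = S.cls a' b')
    (h₂ : S.cls a c = S.cls a' c') (j : Fin 3) :
    face j false (glue (sq a b c d) (sq a' b' c' d')) ∈ S.P := by
  fin_cases j
  · exact (face₀_glue _ _).symm ▸ S.cls_eq_cls.1 h₀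
  · exact (face₁_glue (a, b) (c, d) (a', b') (c', d')).symm ▸ S.cls_eq_cls.1 h₁
  · exact (face₂_glue (a, b) (c, d) (a', b') (c', d')).symm ▸ S.cls_eq_cls.1 h₂

/-- Completion of seven points to a parallelepiped at the vertex `111`. -/
theorem exists_box (h₀ : S.cls a b = S.cls c d) (h₁ : S.cls a b = S.cls a' b')
    (h₂ : S.cls a c = S.cls a' c') : ∃ d', S.Box a b c d a' b' c' d' := by
  obtain ⟨d', h⟩ := S.closing₃ _ (face_false_mem (d' := a) h₀ h₁ h₂)
  exact ⟨d', by rwa [update_glue] at h⟩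

/-- Completion of seven points to a parallelepiped at the vertex `110`. -/
theorem exists_box' (h₀ : S.cls a b = S.cls c d) (h₁ : S.cls a b = S.cls a' b')
    (h₂ : S.cls b d = S.cls b' d') : ∃ c', S.Box a b c d a' b' c' d' := by
  obtain ⟨c', h⟩ := exists_box (a := b) (b := a) (c := d) (d := c) (a' := b') (b' := a') (c' := d')
    (congrArg (·⁻¹) h₀) (congrArg (·⁻¹) h₁) h₂
  exact ⟨c', h.reflect⟩

theorem Box.cls_left (h : S.Box a b c d a' b' c' d') : S.cls a c = S.cls a' c' :=
  h.transpose.exchange.cls_eq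

theorem Box.cls_front (h : S.Box a b c d a' b' c' d') : S.cls a b = S.cls a' b' :=
  h.exchange.cls_eq

theorem Box.unique (hS : S.IsStrong) {e : X} (h : S.Box a b c d a' b' c' d')
    (h' : S.Box a b c d a' b' c' e) : d' = e := by
  refine hS _ (face_false_mem (d' := a) h.cls_eq h.cls_front h.cls_left) d' e ?_ ?_
  · rwa [update_glue]
  · rwa [update_glue]

theorem Box.unique' (hS : S.IsStrong) {e : X} (h : S.Box a b c d a' b' c' d')
    (h' : S.Box a b c d a' b' e d') : c' = e :=
  h.reflect.unique hS h'.reflect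

end ParallelepipedStructure

/-! ### Translations of a strong parallelepiped structure -/

namespace ParallelepipedStructure

variable {X : Type u} (S : ParallelepipedStructure X)

/-- The group of the families of permutations of `X`, indexed by the vertices of the cube, that
preserve the set of parallelepipeds. -/
def boxSymmetries : Subgroup (Cube 3 (Equiv.Perm X)) where
  carrier := {γ | ∀ x : Cube 3 X, (fun ε => γ ε (x ε)) ∈ S.Q ↔ x ∈ S.Q}
  one_mem' _ := Iff.rfl
  mul_mem' hγ hδ x := (hγ _).trans (hδ x)
  inv_mem' {γ} hγ x := by simpa using (hγ fun ε => (γ ε)⁻¹ (x ε)).symm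

/-- The group of the permutations of `X` that preserve parallelepipeds when applied to the four
vertices of a face. It is enough to require this for one face. -/
noncomputable def faceTranslations : Subgroup (Equiv.Perm X) :=
  S.boxSymmetries.comap (onHom _ {ε | ε 0 = false})

/-- The group of the permutations of `X` that preserve parallelepipeds when applied to the two
vertices of an edge. It is enough to require this for one edge. -/
noncomputable def edgeTranslations : Subgroup (Equiv.Perm X) :=
  S.boxSymmetries.comap (onHom _ (edgeSet 0 fun _ => false))

variable {S} {g h u : Equiv.Perm X}

theorem comp_mem_boxSymmetries {γ : Cube 3 (Equiv.Perm X)} (hγ : γ ∈ S.boxSymmetries)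
    {σ : Equiv.Perm (Fin 3 → Bool)} (hσ : IsEuclidean σ) : γ ∘ σ ∈ S.boxSymmetries := by
  intro x
  have h := hγ (x ∘ σ.symm)
  rw [mem_Q_comp_iff hσ.symm, ← mem_Q_comp_iff hσ] at h
  simpa [comp_def] using h

theorem on_face_mem (hg : g ∈ S.faceTranslations) (j : Fin 3) (c : Bool) :
    Cube.on g {ε | ε j = c} ∈ S.boxSymmetries := by
  rw [← preimage_isometry_face, ← on_comp]
  exact comp_mem_boxSymmetries hg (isEuclidean_isometry _ _)

theorem on_edgeSet_mem (hu : u ∈ S.edgeTranslations) (j : Fin 3) (η : Fin 3 → Bool) :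
    Cube.on u (edgeSet j η) ∈ S.boxSymmetries := by
  rw [← preimage_isometry_edgeSet, ← on_comp]
  exact comp_mem_boxSymmetries hu (isEuclidean_isometry _ _)

theorem apply_glue_sq {Y : Type*} (γ : Cube 3 (X → Y)) (a b c d a' b' c' d' : X) :
    (fun ε => γ ε (glue (sq a b c d) (sq a' b' c' d') ε)) =
      glue (sq (γ ![false, false, false] a) (γ ![false, false, true] b)
          (γ ![false, true, false] c) (γ ![false, true, true] d))
        (sq (γ ![true, false, false] a') (γ ![true, false, true] b')
          (γ ![true, true, false] c') (γ ![true, true, true] d')) :=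
  ext₃ (by rintro (_ | _) (_ | _) (_ | _) <;> rfl)

theorem boxSymmetries_box {γ : Cube 3 (Equiv.Perm X)} (hγ : γ ∈ S.boxSymmetries)
    {a b c d a' b' c' d' : X} (h : S.Box a b c d a' b' c' d') :
    S.Box (γ ![false, false, false] a) (γ ![false, false, true] b)
      (γ ![false, true, false] c) (γ ![false, true, true] d)
      (γ ![true, false, false] a') (γ ![true, false, true] b')
      (γ ![true, true, false] c') (γ ![true, true, true] d') :=
  Eq.mp (congrArg (· ∈ S.Q) (apply_glue_sq (fun ε => γ ε) a b c d a' b' c' d')) ((hγ _).2 h)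

theorem glue_eq_glue_sq (x : Cube 3 X) :
    x = glue (sq (x ![false, false, false]) (x ![false, false, true]) (x ![false, true, false])
      (x ![false, true, true])) (sq (x ![true, false, false]) (x ![true, false, true])
      (x ![true, true, false]) (x ![true, true, true])) :=
  ext₃ (by rintro (_ | _) (_ | _) (_ | _) <;> rfl)

theorem mem_Q_iff_box {x : Cube 3 X} :
    x ∈ S.Q ↔ S.Box (x ![false, false, false]) (x ![false, false, true]) (x ![false, true, false])
      (x ![false, true, true]) (x ![true, false, false]) (x ![true, false, true])
      (x ![true, true, false]) (x ![true, true, true]) :=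
  iff_of_eq (congrArg (· ∈ S.Q) (glue_eq_glue_sq x))

theorem mem_faceTranslations
    (hg : ∀ a b c d, S.cls a b = S.cls c d → S.Box a b c d (g a) (g b) (g c) (g d)) :
    g ∈ S.faceTranslations := by
  have hcls : ∀ a b, S.cls a b = S.cls (g a) (g b) := fun a b => (hg a b a b rfl).cls_front
  intro x
  rw [mem_Q_iff_box, mem_Q_iff_box (x := x)]
  simp only [onHom_apply, on_apply, Set.mem_ofPred_eq]
  refine ⟨fun h => ?_, fun h => (hg _ _ _ _ h.cls_eq).symm.trans h⟩
  refine (hg _ _ _ _ ?_).trans h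
  rw [hcls, hcls (x ![false, true, false])]
  exact h.cls_eq

theorem mem_edgeTranslations
    (hu : ∀ a b c d, S.cls a b = S.cls c d → S.Box a b c d (u a) (u b) c d) :
    u ∈ S.edgeTranslations := by
  have hcls : ∀ a b, S.cls a b = S.cls (u a) (u b) := fun a b => (hu a b a b rfl).cls_front
  intro x
  rw [mem_Q_iff_box, mem_Q_iff_box (x := x)]
  simp only [onHom_apply, on_apply, edgeSet, Set.mem_ofPred_eq, Fin.forall_fin_succ]
  -- The edge of direction `0` through `000` is brought into the position of the edge in `hu`.
  refine ⟨fun h => ?_, fun h => ?_⟩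
  · have h' := h.exchange.transpose
    exact ((hu _ _ _ _ ((hcls _ _).trans h'.cls_eq)).trans h').transpose.exchange
  · have h' := h.exchange.transpose
    exact ((hu _ _ _ _ h'.cls_eq).symm.trans h').transpose.exchange

section Moves

variable {a b c d a' b' c' d' : X}

theorem Box.face_right (hg : g ∈ S.faceTranslations) (h : S.Box a b c d a' b' c' d') :
    S.Box a (g b) c (g d) a' (g b') c' (g d') := by
  simpa [on_apply] using boxSymmetries_box (on_face_mem hg 2 true) h

theorem Box.edge_right (hu : u ∈ S.edgeTranslations) (h : S.Box a b c d a' b' c' d') :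
    S.Box a b c d a' (u b') c' (u d') := by
  simpa [on_apply, edgeSet, Fin.forall_fin_succ] using
    boxSymmetries_box (on_edgeSet_mem hu 1 ![true, true, true]) h

theorem Box.edge_last (hu : u ∈ S.edgeTranslations) (h : S.Box a b c d a' b' c' d') :
    S.Box a b c d a' b' (u c') (u d') := by
  simpa [on_apply, edgeSet, Fin.forall_fin_succ] using
    boxSymmetries_box (on_edgeSet_mem hu 2 ![true, true, true]) h

theorem Box.edge_first (hu : u ∈ S.edgeTranslations) (h : S.Box a b c d a' b' c' d') :
    S.Box a b c d (u a') (u b') c' d' := by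
  simpa [on_apply, edgeSet, Fin.forall_fin_succ] using
    boxSymmetries_box (on_edgeSet_mem hu 2 ![true, false, true]) h

end Moves

theorem edgeTranslations_le : S.edgeTranslations ≤ S.faceTranslations := fun _ hu =>
  mem_faceTranslations fun _ _ _ _ h => ((box_refl h).edge_first hu).edge_last hu

theorem cls_apply_eq (hg : g ∈ S.faceTranslations) (x y : X) :
    S.cls x (g x) = S.cls y (g y) :=
  ((box_refl (a := x) (b := x) (c := y) (d := y) (S.cls_self _ _)).face_right hg).cls_eq

theorem cls_edge_apply (hu : u ∈ S.edgeTranslations) (x : X) : S.cls x (u x) = 1 := by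
  rw [S.one_eq_cls x]
  exact ((box_refl (a := x) (b := x) (c := x) (d := x) rfl).edge_last hu).cls_left.symm

/-- An edge translation with a fixed point is trivial. -/
theorem edge_eq_one (hS : S.IsStrong) (hu : u ∈ S.edgeTranslations) {x : X} (hx : u x = x) :
    u = 1 := by
  ext y
  have h := box_refl (S := S) (a := x) (b := y) (c := x) (d := y) rfl
  have h' := h.edge_last hu
  rw [hx] at h'
  exact h'.unique hS h

open scoped commutatorElement

/-- Two faces of different directions meet in an edge, so the commutator of two face translations
is an edge translation. -/
theorem commutator_mem_edgeTranslations (hg : g ∈ S.faceTranslations)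
    (hh : h ∈ S.faceTranslations) : ⁅g, h⁆ ∈ S.edgeTranslations := by
  have key := S.boxSymmetries.commutator_le_self (Subgroup.commutator_mem_commutator
    (on_face_mem hg 1 false) (on_face_mem hh 2 false))
  rw [commutatorElement_on] at key
  have e : edgeSet 0 (fun _ => false) = {ε : Fin 3 → Bool | ε 1 = false} ∩ {ε | ε 2 = false} := by
    ext ε
    simp [edgeSet, Fin.forall_fin_succ]
  exact (congrArg (fun α => Cube.on ⁅g, h⁆ α ∈ S.boxSymmetries) e).mpr key

/-- An edge and a face can meet in a single vertex, and in a strong structure a permutation that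
preserves parallelepipeds when applied to a single vertex is trivial. -/
theorem edge_commute (hS : S.IsStrong) (hu : u ∈ S.edgeTranslations)
    (hg : g ∈ S.faceTranslations) : u * g = g * u := by
  have key := S.boxSymmetries.commutator_le_self (Subgroup.commutator_mem_commutator
    (on_edgeSet_mem hu 0 ![true, true, true]) (on_face_mem hg 0 true))
  rw [commutatorElement_on] at key
  rw [← commutatorElement_eq_one_iff_mul_comm]
  ext x
  have h₀ := box_refl (S := S) (a := x) (b := x) (c := x) (d := x) rfl
  have h := boxSymmetries_box key h₀
  simp only [on_apply, edgeSet, Fin.forall_fin_succ, Set.mem_inter_iff, Set.mem_ofPred_eq] at h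
  exact Box.unique (a := x) (b := x) (c := x) (d := x) (a' := x) (b' := x) (c' := x) hS
    (by simpa using h) h₀

end ParallelepipedStructure

namespace ParallelepipedStructure

variable {X : Type u} {S : ParallelepipedStructure X}

/-! ### Translations from sections of `q_s` -/

variable (S) in
/-- The class `⟨a, b, c, d⟩` in `P_s`, where `a, b` and `c, d` are pairs of class `s`. -/
def bcls {s : S.Base} (p r : S.Pairs s) : S.PGroup s := (S.pairStructure s).cls p r

section Classes

variable {s : S.Base} {a b x y : X}

theorem bcls_eq {p r p' r' : S.Pairs s} :
    S.bcls p r = S.bcls p' r' ↔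
      S.Box p.1.1 p.1.2 r.1.1 r.1.2 p'.1.1 p'.1.2 r'.1.1 r'.1.2 :=
  S.pair_cls_eq

theorem bcls_mul (p r t : S.Pairs s) : S.bcls p r * S.bcls r t = S.bcls p t :=
  ParallelogramStructure.cls_mul_cls _ _ _ _

theorem bcls_self (p : S.Pairs s) : S.bcls p p = 1 :=
  (ParallelogramStructure.one_eq_cls _ _).symm

theorem q_bcls' (p r : S.Pairs s) : S.q s (S.bcls p r) = S.cls p.1.2 r.1.2 :=
  S.cls_swap.1 (p.2.trans r.2.symm)

theorem exists_bcls (w : S.PGroup s) (hab : S.cls a b = s) (hx : S.cls a x = S.q s w) :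
    ∃ (y : X) (hy : S.cls x y = s), S.bcls ⟨(a, b), hab⟩ ⟨(x, y), hy⟩ = w := by
  obtain ⟨⟨⟨c, d⟩, hcd⟩, rfl⟩ := (S.pairStructure s).exists_cls_eq w ⟨(a, b), hab⟩
  obtain ⟨y, hy⟩ := exists_box (hab.trans hcd.symm) (rfl : S.cls a b = S.cls a b) hx.symm
  refine ⟨y, hy.cls_eq'.symm.trans hab, ?_⟩
  exact bcls_eq.2 hy.symm

theorem exists_bcls' (w : S.PGroup s) (hab : S.cls a b = s) (hy : S.cls b y = S.q s w) :
    ∃ (x : X) (hx : S.cls x y = s), S.bcls ⟨(a, b), hab⟩ ⟨(x, y), hx⟩ = w := by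
  obtain ⟨⟨⟨c, d⟩, hcd⟩, rfl⟩ := (S.pairStructure s).exists_cls_eq w ⟨(a, b), hab⟩
  have hbd : S.cls b d = S.cls b y := (q_bcls' ⟨(a, b), hab⟩ ⟨(c, d), hcd⟩).symm.trans hy.symm
  obtain ⟨x, hx⟩ := exists_box' (hab.trans hcd.symm) (rfl : S.cls a b = S.cls a b) hbd
  refine ⟨x, hx.cls_eq'.symm.trans hab, ?_⟩
  exact bcls_eq.2 hx.symm

theorem bcls_snd_unique (hS : S.IsStrong) {hab : S.cls a b = s} {y' : X} (hy : S.cls x y = s)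
    (hy' : S.cls x y' = s)
    (h : S.bcls ⟨(a, b), hab⟩ ⟨(x, y), hy⟩ = S.bcls ⟨(a, b), hab⟩ ⟨(x, y'), hy'⟩) : y = y' :=
  (box_refl (hab.trans hy.symm)).unique hS (bcls_eq.1 h)

theorem bcls_fst_unique (hS : S.IsStrong) {hab : S.cls a b = s} {x' : X} (hx : S.cls x y = s)
    (hx' : S.cls x' y = s)
    (h : S.bcls ⟨(a, b), hab⟩ ⟨(x, y), hx⟩ = S.bcls ⟨(a, b), hab⟩ ⟨(x', y), hx'⟩) : x = x' :=
  (box_refl (hab.trans hx.symm)).unique' hS (bcls_eq.1 h)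

end Classes

/-- A homomorphic section `σ` of `q_s` and a pair `(a, b)` of class `s` determine a permutation of
`X` that sends `a` to `b`: the image of `x` is the point `y` such that
`⟨a, b, x, y⟩` is the value of `σ` at the class of `(a, x)`. Then `⟨x, g x, y, g y⟩` depends only on
the class of `(x, y)`. -/
theorem exists_perm_of_section (hS : S.IsStrong) {s : S.Base} (σ : S.Base →* S.PGroup s)
    (hσ : ∀ t, S.q s (σ t) = t) {a b : X} (hab : S.cls a b = s) :
    ∃ (g : Equiv.Perm X) (hg : ∀ x, S.cls x (g x) = s), g a = b ∧
      ∀ x y, S.bcls ⟨(x, g x), hg x⟩ ⟨(y, g y), hg y⟩ = σ (S.cls x y) := by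
  choose g hg hgσ using fun x => exists_bcls (σ (S.cls a x)) hab (hσ _).symm
  choose f hf hfσ using fun y => exists_bcls' (σ (S.cls b y)) hab (hσ _).symm
  refine ⟨⟨g, f, fun x => ?_, fun y => ?_⟩, hg, ?_, fun x y => ?_⟩
  · have e : S.cls b (g x) = S.cls a x := (S.cls_swap.1 (hab.trans (hg x).symm)).symm
    refine bcls_fst_unique hS (hab := hab) (hf (g x)) (hg x) ?_
    rw [hfσ, hgσ, e]
  · have e : S.cls b y = S.cls a (f y) := (S.cls_swap.1 (hab.trans (hf y).symm)).symm
    refine bcls_snd_unique hS (hab := hab) (hg (f y)) (hf y) ?_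
    rw [hfσ, hgσ, e]
  · refine bcls_snd_unique hS (hab := hab) (hg a) hab ?_
    exact (hgσ a).trans (by rw [bcls_self, ← S.one_eq_cls, map_one])
  · have h : S.bcls ⟨(a, b), hab⟩ ⟨(x, g x), hg x⟩ * S.bcls ⟨(x, g x), hg x⟩ ⟨(y, g y), hg y⟩
        = S.bcls ⟨(a, b), hab⟩ ⟨(y, g y), hg y⟩ := bcls_mul _ _ _
    rw [hgσ, hgσ, ← S.cls_mul_cls a x y, map_mul] at h
    exact mul_left_cancel h

/-- If `q_s` has a homomorphic section, then some face translation moves `a` to `b`, for any pair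
`(a, b)` of class `s`. -/
theorem exists_faceTranslation (hS : S.IsStrong) {s : S.Base} (σ : S.Base →* S.PGroup s)
    (hσ : ∀ t, S.q s (σ t) = t) {a b : X} (hab : S.cls a b = s) :
    ∃ g ∈ S.faceTranslations, g a = b := by
  obtain ⟨g, hg, hgab, hgσ⟩ := exists_perm_of_section hS σ hσ hab
  refine ⟨g, mem_faceTranslations fun x y z w h => ?_, hgab⟩
  have hb := bcls_eq.1 ((hgσ x y).trans ((congrArg σ h).trans (hgσ z w).symm))
  exact hb.transpose.exchange

variable (S) in
/-- The section of `q₁` that sends the class of `(x, y)` to `⟨x, x, y, y⟩`. -/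
noncomputable def diagonal : S.Base →* S.PGroup 1 :=
  MonoidHom.mk'
    (fun t => Quotient.liftOn t
      (fun p => S.bcls ⟨(p.1, p.1), (S.one_eq_cls _).symm⟩
        ⟨(p.2, p.2), (S.one_eq_cls _).symm⟩) <| by
      rintro ⟨a, b⟩ ⟨c, d⟩ h
      have h : S.cls a b = S.cls c d := Quotient.sound (s := S.setoid) h
      exact bcls_eq.2 (box_refl h).exchange.transpose) <| by
    intro s t
    obtain ⟨a⟩ := S.nonempty
    obtain ⟨b, rfl⟩ := S.exists_cls_eq s a
    obtain ⟨c, rfl⟩ := S.exists_cls_eq t b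
    rw [S.cls_mul_cls]
    exact (bcls_mul _ _ _).symm

theorem diagonal_cls (x y : X) :
    S.diagonal (S.cls x y) =
      S.bcls ⟨(x, x), (S.one_eq_cls _).symm⟩ ⟨(y, y), (S.one_eq_cls _).symm⟩ := rfl

theorem q_diagonal (t : S.Base) : S.q 1 (S.diagonal t) = t := by
  obtain ⟨a⟩ := S.nonempty
  obtain ⟨b, rfl⟩ := S.exists_cls_eq t a
  rfl

/-- The edge translations act transitively on the fibers of `X`, the classes of the relation
`S.cls a b = 1`: the permutation defined by the diagonal section is an edge translation. -/
theorem exists_edgeTranslation (hS : S.IsStrong) {a b : X} (hab : S.cls a b = 1) :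
    ∃ u ∈ S.edgeTranslations, u a = b := by
  obtain ⟨u, hu, huab, huσ⟩ := exists_perm_of_section hS S.diagonal q_diagonal hab
  refine ⟨u, mem_edgeTranslations fun x y z w h => ?_, huab⟩
  have hb := bcls_eq.1 ((huσ x y).trans ((congrArg S.diagonal h).trans (diagonal_cls z w)))
  exact hb.transpose.exchange

/-! ### Splitting of `q_s` -/

/-- The edge translations form a group isomorphic to the kernel of `q_s`, for every `s`: for a
fixed pair `(a, b)` of class `s`, send `u` to `⟨a, b, a, u b⟩`. -/
theorem nonempty_edgeTranslations_mulEquiv (hS : S.IsStrong) (s : S.Base) :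
    Nonempty (S.edgeTranslations ≃* (S.q s).ker) := by
  obtain ⟨⟨⟨a, b⟩, hab⟩⟩ := (S.pairStructure s).nonempty
  change S.cls a b = s at hab
  have hu : ∀ u : S.edgeTranslations, S.cls a (u.1 b) = s := fun u => by
    rw [← S.cls_mul_cls a b, cls_edge_apply u.2, mul_one, hab]
  let f : S.edgeTranslations →* (S.q s).ker :=
    MonoidHom.mk'
      (fun u => ⟨S.bcls ⟨(a, b), hab⟩ ⟨(a, u.1 b), hu u⟩, (S.one_eq_cls a).symm⟩) fun u v => by
        ext
        change S.bcls ⟨(a, b), hab⟩ ⟨(a, (u * v).1 b), hu _⟩ =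
          S.bcls ⟨(a, b), hab⟩ ⟨(a, u.1 b), hu u⟩ * S.bcls ⟨(a, b), hab⟩ ⟨(a, v.1 b), hu v⟩
        have e : S.bcls ⟨(a, b), hab⟩ ⟨(a, u.1 b), hu u⟩
            = S.bcls ⟨(a, v.1 b), hu v⟩ ⟨(a, (u * v).1 b), hu _⟩ := by
          have h₀ := bcls_eq.1 ((bcls_self (⟨(a, b), hab⟩ : S.Pairs s)).trans
            (bcls_self (⟨(a, v.1 b), hu v⟩ : S.Pairs s)).symm)
          exact bcls_eq.2 (h₀.exchange.edge_right u.2).exchange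
        rw [mul_comm, e, bcls_mul]
  refine ⟨MulEquiv.ofBijective f ⟨(injective_iff_map_eq_one f).2 fun u h => ?_, ?_⟩⟩
  · have h' : S.bcls ⟨(a, b), hab⟩ ⟨(a, u.1 b), hu u⟩ = S.bcls ⟨(a, b), hab⟩ ⟨(a, b), hab⟩ :=
      (congrArg Subtype.val h).trans (bcls_self _).symm
    exact Subtype.ext (edge_eq_one hS u.2 (bcls_snd_unique hS _ _ h'))
  · rintro ⟨w, hw⟩
    have hq : S.cls a a = S.q s w := by rw [(MonoidHom.mem_ker).1 hw, S.one_eq_cls a]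
    obtain ⟨y, hy, rfl⟩ := exists_bcls w hab hq
    have hby : S.cls b y = 1 := by
      rw [S.one_eq_cls a]
      exact (S.cls_swap.1 (hab.trans hy.symm)).symm
    obtain ⟨u, hu', rfl⟩ := exists_edgeTranslation hS hby
    exact ⟨⟨u, hu'⟩, rfl⟩

theorem q_surjective (s : S.Base) : Surjective (S.q s) := by
  intro t
  obtain ⟨⟨⟨a, b⟩, hab⟩⟩ := (S.pairStructure s).nonempty
  obtain ⟨c, rfl⟩ := S.exists_cls_eq t a
  obtain ⟨d, hd⟩ := S.exists_cls_eq s c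
  exact ⟨S.bcls ⟨(a, b), hab⟩ ⟨(c, d), hd⟩, rfl⟩

end ParallelepipedStructure

/-- A surjective homomorphism of abelian groups whose kernel is an injective `ℤ`-module has a
section. -/
theorem MonoidHom.exists_section_of_injective_ker {A : Type*} {B : Type*} [CommGroup A]
    [CommGroup B] (f : A →* B) (hf : Surjective f) (h : Module.Baer ℤ (Additive f.ker)) :
    ∃ σ : B →* A, ∀ b, f (σ b) = b := by
  obtain ⟨r, hr⟩ := h.extension_property_addMonoidHom (MonoidHom.toAdditive f.ker.subtype)
    f.ker.subtype_injective (AddMonoidHom.id _)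
  -- `p` is the projection of `A` onto the complement of the kernel given by the retraction `r`.
  let p : A →* A := MonoidHom.id A / f.ker.subtype.comp (MonoidHom.toAdditive.symm r)
  have hp : f.ker ≤ p.ker := fun a ha => by
    have := DFunLike.congr_fun hr (Additive.ofMul ⟨a, ha⟩)
    have := congrArg (fun z : Additive f.ker => (z.toMul : A)) this
    exact div_eq_one.2 this.symm
  refine ⟨f.liftOfSurjective hf ⟨p, hp⟩, fun b => ?_⟩
  obtain ⟨a, rfl⟩ := hf b
  rw [MonoidHom.liftOfRightInverse_comp_apply]
  change f (a / _) = f a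
  rw [map_div, div_eq_self]
  exact (MonoidHom.toAdditive.symm r a).2

/-- A surjective homomorphism onto a projective abelian group has a section. -/
theorem MonoidHom.exists_section_of_projective {A : Type*} {B : Type*} [CommGroup A]
    [CommGroup B] (f : A →* B) (hf : Surjective f) (h : Module.Projective ℤ (Additive B)) :
    ∃ σ : B →* A, ∀ b, f (σ b) = b := by
  obtain ⟨σ, hσ⟩ := Module.projective_lifting_property
    (MonoidHom.toAdditive f).toIntLinearMap LinearMap.id hf
  exact ⟨MonoidHom.toAdditive.symm σ.toAddMonoidHom, fun b => LinearMap.congr_fun hσ (.ofMul b)⟩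

namespace ParallelepipedStructure

variable {X : Type u} {S : ParallelepipedStructure X}

theorem exists_section (hS : S.IsStrong)
    (h : Module.Injective ℤ (Additive S.FiberGroup) ∨ Module.Projective ℤ (Additive S.Base))
    (s : S.Base) : ∃ σ : S.Base →* S.PGroup s, ∀ t, S.q s (σ t) = t := by
  rcases h with h | h
  · obtain ⟨e⟩ := nonempty_edgeTranslations_mulEquiv hS s
    obtain ⟨e₁⟩ := nonempty_edgeTranslations_mulEquiv hS 1
    exact (S.q s).exists_section_of_injective_ker (q_surjective s) <|
      (Module.Baer.of_injective h).of_equiv (e₁.symm.trans e).toAdditive.toIntLinearEquiv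
  · exact (S.q s).exists_section_of_projective (q_surjective s) h

/-- The face translations act transitively on `X`. -/
theorem exists_faceTranslation_apply_eq (hS : S.IsStrong)
    (h : Module.Injective ℤ (Additive S.FiberGroup) ∨ Module.Projective ℤ (Additive S.Base))
    (a b : X) : ∃ g ∈ S.faceTranslations, g a = b := by
  obtain ⟨σ, hσ⟩ := exists_section hS h (S.cls a b)
  exact exists_faceTranslation hS σ hσ rfl

end ParallelepipedStructure

namespace ParallelepipedStructure

variable {X : Type u} {S : ParallelepipedStructure X}

/-! ### The structure as a nilmanifold -/

variable (S) in
/-- The edge translations as a subgroup of the group of face translations. -/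
noncomputable def centralSubgroup : Subgroup S.faceTranslations :=
  S.edgeTranslations.subgroupOf S.faceTranslations

theorem commutator_le_centralSubgroup : commutator S.faceTranslations ≤ S.centralSubgroup := by
  rw [commutator_def, Subgroup.commutator_le]
  rintro g - h -
  exact commutator_mem_edgeTranslations g.2 h.2

theorem centralSubgroup_le_center (hS : S.IsStrong) :
    S.centralSubgroup ≤ Subgroup.center S.faceTranslations := fun _ hu =>
  Subgroup.mem_center_iff.2 fun g => Subtype.ext (edge_commute hS hu g.2).symm

theorem stabilizer_inf_centralSubgroup (hS : S.IsStrong) (e : X) :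
    MulAction.stabilizer S.faceTranslations e ⊓ S.centralSubgroup = ⊥ := by
  rw [eq_bot_iff]
  rintro g ⟨hg, hu⟩
  exact Subtype.ext (edge_eq_one hS hu hg)

theorem const_mem_Q (e : X) : (fun _ => e) ∈ S.Q :=
  mem_Q_iff_box.2 (box_refl rfl)

theorem mem_P_iff_cls {x : Cube 2 X} :
    x ∈ S.P ↔ S.cls (x ![false, false]) (x ![false, true]) =
      S.cls (x ![true, false]) (x ![true, true]) := by
  rw [S.cls_eq_cls]
  exact iff_of_eq (congrArg (· ∈ S.P) (ext₂ (by rintro (_ | _) (_ | _) <;> rfl)))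

/-- A parallelogram `x` is a face of the parallelepiped `(x, x)`, and conversely. -/
theorem comp_tail_mem_Q_iff {x : Cube 2 X} : x ∘ Fin.tail (α := fun _ => Bool) ∈ S.Q ↔ x ∈ S.P := by
  have e : glue x x = x ∘ Fin.tail (α := fun _ => Bool) :=
    ext₃ (by rintro (_ | _) (_ | _) (_ | _) <;> rfl)
  rw [← e]
  exact ⟨fun h => face₀_glue x x ▸ S.face_mem _ h 0 false, fun h => S.equivalence₃.refl ⟨x, h⟩⟩

theorem coe_mem_boxSymmetries_of_mem_faceGroup {γ : Cube 3 S.faceTranslations}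
    (hγ : γ ∈ faceGroup S.faceTranslations) :
    (fun ε => (γ ε : Equiv.Perm X)) ∈ S.boxSymmetries := by
  have key : faceGroup S.faceTranslations ≤
      S.boxSymmetries.comap (S.faceTranslations.subtype.compLeft (Fin 3 → Bool)) := by
    refine (Subgroup.closure_le _).2 ?_
    rintro _ ⟨g, j, c, rfl⟩
    exact (congrArg (· ∈ S.boxSymmetries)
      (map_on S.faceTranslations.subtype g {ε | ε j = c})).mpr (on_face_mem g.2 j c)
  exact key hγ

theorem coe_mem_boxSymmetries_of_mem_edgeGroup {γ : Cube 3 S.faceTranslations}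
    (hγ : γ ∈ edgeGroup 3 S.centralSubgroup) :
    (fun ε => (γ ε : Equiv.Perm X)) ∈ S.boxSymmetries := by
  have key : edgeGroup 3 S.centralSubgroup ≤
      S.boxSymmetries.comap (S.faceTranslations.subtype.compLeft (Fin 3 → Bool)) := by
    refine (Subgroup.closure_le _).2 ?_
    rintro _ ⟨u, hu, j, η, rfl⟩
    exact (congrArg (· ∈ S.boxSymmetries)
      (map_on S.faceTranslations.subtype u (edgeSet j η))).mpr (on_edgeSet_mem hu j η)
  exact key hγ

theorem preimage_tail_edgeSet (j : Fin 2) (η : Fin 2 → Bool) :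
    (Fin.tail (α := fun _ : Fin 3 => Bool)) ⁻¹' edgeSet j η
      = {ε | ε (Fin.succ j.rev) = η j.rev} := by
  ext ε
  fin_cases j <;> simp [edgeSet, Fin.forall_fin_two, Fin.tail]

/-- Doubling turns the edges of the square into faces of the cube. -/
theorem coe_comp_tail_mem_boxSymmetries {γ : Cube 2 S.faceTranslations}
    (hγ : γ ∈ edgeGroup 2 (⊤ : Subgroup S.faceTranslations)) :
    (fun ε => (γ (Fin.tail (α := fun _ => Bool) ε) : Equiv.Perm X)) ∈ S.boxSymmetries := by
  let f : Cube 2 S.faceTranslations →* Cube 3 (Equiv.Perm X) :=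
    { toFun := fun γ ε => (γ (Fin.tail (α := fun _ => Bool) ε) : Equiv.Perm X)
      map_one' := rfl
      map_mul' := fun _ _ => rfl }
  have key : edgeGroup 2 (⊤ : Subgroup S.faceTranslations) ≤ S.boxSymmetries.comap f := by
    refine (Subgroup.closure_le _).2 ?_
    rintro _ ⟨g, -, j, η, rfl⟩
    have h := on_face_mem g.2 (Fin.succ j.rev) (η j.rev)
    rw [← preimage_tail_edgeSet] at h
    exact (congrArg (fun δ : Cube 2 (Equiv.Perm X) => δ ∘ Fin.tail (α := fun _ => Bool)
      ∈ S.boxSymmetries) (map_on S.faceTranslations.subtype g (edgeSet j η))).mpr h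
  exact key hγ

theorem cls_edge_apply_edge_apply {u v : Equiv.Perm X} (hu : u ∈ S.edgeTranslations)
    (hv : v ∈ S.edgeTranslations) (a b : X) : S.cls (u a) (v b) = S.cls a b := by
  rw [← one_mul (S.cls (u a) (v b)), ← cls_edge_apply hu a, S.cls_mul_cls,
    ← S.cls_mul_cls a b (v b), cls_edge_apply hv, mul_one]

theorem apply_mem_P_of_mem_nilP {γ : Cube 2 S.faceTranslations} (hγ : γ ∈ nilP S.centralSubgroup)
    (e : X) : (fun ε => γ ε • e) ∈ S.P := by
  obtain ⟨g, hg, f, hf, rfl⟩ := hγ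
  have h : (fun ε => f ε • e) ∈ S.P := by
    refine mem_P_iff_cls.2 ?_
    exact (cls_edge_apply_edge_apply (hf _) (hf _) e e).trans
      (cls_edge_apply_edge_apply (hf _) (hf _) e e).symm
  exact comp_tail_mem_Q_iff.1
    ((coe_comp_tail_mem_boxSymmetries hg _).2 (comp_tail_mem_Q_iff.2 h))

theorem apply_mem_Q_of_mem_nilQ {γ : Cube 3 S.faceTranslations} (hγ : γ ∈ nilQ S.centralSubgroup)
    (e : X) : (fun ε => γ ε • e) ∈ S.Q := by
  obtain ⟨g, hg, f, hf, rfl⟩ := hγ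
  exact (coe_mem_boxSymmetries_of_mem_faceGroup hg _).2
    ((coe_mem_boxSymmetries_of_mem_edgeGroup hf _).2 (const_mem_Q e))

variable {G : Type u} [Group G]

theorem on_mem_faceGroup (g : G) (j : Fin 3) (c : Bool) :
    Cube.on g {ε | ε j = c} ∈ faceGroup G :=
  Subgroup.subset_closure ⟨g, j, c, rfl⟩

theorem on_mem_edgeGroup {k : ℕ} {H : Subgroup G} {g : G} (hg : g ∈ H) (j : Fin k)
    (η : Fin k → Bool) : Cube.on g (edgeSet j η) ∈ edgeGroup k H :=
  Subgroup.subset_closure ⟨g, hg, j, η, rfl⟩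

/-- The fourth vertex of a parallelogram with vertices `a, b, c, d` lies in the fiber of `g b`, for
every face translation `g` that moves `a` to `c`. -/
theorem cls_fourth_vertex {g : Equiv.Perm X} (hg : g ∈ S.faceTranslations) {a b c d : X}
    (hac : g a = c) (h : S.cls a b = S.cls c d) : S.cls (g b) d = 1 := by
  have h' := cls_apply_eq hg a b
  rw [hac] at h'
  rw [← mul_eq_left (a := S.cls c (g b)), S.cls_mul_cls, ← h]
  exact S.cls_swap.1 h'

/-- Starting from the constant square `e`, translations applied to edges produce three vertices of
the parallelogram `x`, and a central translation at the vertex `11` produces the last one. -/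
theorem exists_nilP_of_mem_P (hS : S.IsStrong)
    (ht : ∀ a b : X, ∃ g ∈ S.faceTranslations, g a = b) (e : X) {x : Cube 2 X} (hx : x ∈ S.P) :
    ∃ γ ∈ nilP S.centralSubgroup, ∀ ε, γ ε • e = x ε := by
  rw [mem_P_iff_cls] at hx
  obtain ⟨g₀, hg₀, h₀⟩ := ht e (x ![false, false])
  obtain ⟨g₁, hg₁, h₁⟩ := ht (x ![false, false]) (x ![false, true])
  obtain ⟨g₂, hg₂, h₂⟩ := ht (x ![false, false]) (x ![true, false])
  obtain ⟨u, hu, h₃⟩ := exists_edgeTranslation hS (cls_fourth_vertex hg₂ h₂ hx)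
  have hc : ∀ g ∈ S.faceTranslations, ∀ y, g (u y) = u (g y) := fun g hg y =>
    (Equiv.Perm.congr_fun (edge_commute hS hu hg) y).symm
  lift g₀ to S.faceTranslations using hg₀
  lift g₁ to S.faceTranslations using hg₁
  lift g₂ to S.faceTranslations using hg₂
  let u' : S.faceTranslations := ⟨u, edgeTranslations_le hu⟩
  have hu' : u' ∈ S.centralSubgroup := hu
  -- `g₀` acts on the whole square, as the product of its actions on two opposite edges.
  refine ⟨Cube.on g₂ (edgeSet 1 ![true, true]) * Cube.on g₁ (edgeSet 0 ![true, true]) *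
    (Cube.on g₀ (edgeSet 1 ![true, true]) * Cube.on g₀ (edgeSet 1 ![false, true])) *
    (fun ε => if ε = ![true, true] then u' else 1), ⟨_, mul_mem (mul_mem
      (on_mem_edgeGroup (Subgroup.mem_top _) _ _) (on_mem_edgeGroup (Subgroup.mem_top _) _ _))
      (mul_mem (on_mem_edgeGroup (Subgroup.mem_top _) _ _)
        (on_mem_edgeGroup (Subgroup.mem_top _) _ _)), _, fun ε => ?_, rfl⟩, ?_⟩
  · split_ifs
    exacts [hu', one_mem _]
  · refine congrFun (ext₂ ?_)
    rintro (_ | _) (_ | _) <;>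
      simp [on_apply, edgeSet, Fin.forall_fin_two, Subgroup.smul_def, u', hc, h₀, h₁, h₂, h₃]

/-- Starting from the constant cube `e`, translations applied to faces produce the vertices `000`,
`001`, `010` and `100` of the parallelepiped `x`. Central translations applied to the three edges
through `111` then produce `011`, `101` and `110`, and the last vertex is right by uniqueness. -/
theorem exists_nilQ_of_mem_Q (hS : S.IsStrong)
    (ht : ∀ a b : X, ∃ g ∈ S.faceTranslations, g a = b) (e : X) {x : Cube 3 X} (hx : x ∈ S.Q) :
    ∃ γ ∈ nilQ S.centralSubgroup, ∀ ε, γ ε • e = x ε := by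
  rw [mem_Q_iff_box] at hx
  obtain ⟨g₀, hg₀, h₀⟩ := ht e (x ![false, false, false])
  obtain ⟨g₁, hg₁, h₁⟩ := ht (x ![false, false, false]) (x ![false, false, true])
  obtain ⟨g₂, hg₂, h₂⟩ := ht (x ![false, false, false]) (x ![false, true, false])
  obtain ⟨g₃, hg₃, h₃⟩ := ht (x ![false, false, false]) (x ![true, false, false])
  obtain ⟨u₁, hu₁, k₁⟩ := exists_edgeTranslation hS (cls_fourth_vertex hg₂ h₂ hx.cls_eq)
  obtain ⟨u₂, hu₂, k₂⟩ := exists_edgeTranslation hS (cls_fourth_vertex hg₃ h₃ hx.cls_front)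
  obtain ⟨u₃, hu₃, k₃⟩ := exists_edgeTranslation hS (cls_fourth_vertex hg₃ h₃ hx.cls_left)
  have hc : ∀ u ∈ S.edgeTranslations, ∀ g ∈ S.faceTranslations, ∀ y, g (u y) = u (g y) :=
    fun u hu g hg y => (Equiv.Perm.congr_fun (edge_commute hS hu hg) y).symm
  have hc₁ := hc u₁ hu₁
  have hc₂ := hc u₂ hu₂
  have hc₃ := hc u₃ hu₃
  lift g₀ to S.faceTranslations using hg₀
  lift g₁ to S.faceTranslations using hg₁
  lift g₂ to S.faceTranslations using hg₂
  lift g₃ to S.faceTranslations using hg₃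
  let v (u : Equiv.Perm X) (hu : u ∈ S.edgeTranslations) : S.faceTranslations :=
    ⟨u, edgeTranslations_le hu⟩
  have hv : ∀ u hu, v u hu ∈ S.centralSubgroup := fun _ hu => hu
  -- `g₀` acts on the whole cube, as the product of its actions on two opposite faces.
  let γ : Cube 3 S.faceTranslations :=
    Cube.on g₃ {ε | ε 0 = true} * Cube.on g₂ {ε | ε 1 = true} * Cube.on g₁ {ε | ε 2 = true} *
    (Cube.on g₀ {ε | ε 0 = true} * Cube.on g₀ {ε | ε 0 = false}) *
    (Cube.on (v u₁ hu₁) (edgeSet 0 ![true, true, true]) *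
      Cube.on (v u₂ hu₂) (edgeSet 1 ![true, true, true]) *
      Cube.on (v u₃ hu₃) (edgeSet 2 ![true, true, true]))
  have hγ : γ ∈ nilQ S.centralSubgroup := by
    exact ⟨_, mul_mem (mul_mem (mul_mem (on_mem_faceGroup _ _ _) (on_mem_faceGroup _ _ _))
      (on_mem_faceGroup _ _ _)) (mul_mem (on_mem_faceGroup _ _ _) (on_mem_faceGroup _ _ _)), _,
      mul_mem (mul_mem (on_mem_edgeGroup (hv _ hu₁) _ _) (on_mem_edgeGroup (hv _ hu₂) _ _))
        (on_mem_edgeGroup (hv _ hu₃) _ _), rfl⟩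
  refine ⟨γ, hγ, ?_⟩
  have e₀ : γ ![false, false, false] • e = x ![false, false, false] := by
    simp [γ, on_apply, edgeSet, Fin.forall_fin_succ, Subgroup.smul_def, h₀]
  have e₁ : γ ![false, false, true] • e = x ![false, false, true] := by
    simp [γ, on_apply, edgeSet, Fin.forall_fin_succ, Subgroup.smul_def, h₀, h₁]
  have e₂ : γ ![false, true, false] • e = x ![false, true, false] := by
    simp [γ, on_apply, edgeSet, Fin.forall_fin_succ, Subgroup.smul_def, h₀, h₂]
  have e₃ : γ ![true, false, false] • e = x ![true, false, false] := by
    simp [γ, on_apply, edgeSet, Fin.forall_fin_succ, Subgroup.smul_def, h₀, h₃]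
  have e₄ : γ ![false, true, true] • e = x ![false, true, true] := by
    simp [γ, on_apply, edgeSet, Fin.forall_fin_succ, Subgroup.smul_def, v, hc₁, h₀, h₁, k₁]
  have e₅ : γ ![true, false, true] • e = x ![true, false, true] := by
    simp [γ, on_apply, edgeSet, Fin.forall_fin_succ, Subgroup.smul_def, v, hc₂, h₀, h₁, k₂]
  have e₆ : γ ![true, true, false] • e = x ![true, true, false] := by
    simp [γ, on_apply, edgeSet, Fin.forall_fin_succ, Subgroup.smul_def, v, hc₃, h₀, h₂, k₃]
  have h := mem_Q_iff_box.1 (apply_mem_Q_of_mem_nilQ hγ e)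
  rw [e₀, e₁, e₂, e₃, e₄, e₅, e₆] at h
  have e₇ := h.unique hS hx
  refine congrFun (ext₃ ?_)
  rintro (_ | _) (_ | _) (_ | _)
  exacts [e₀, e₁, e₂, e₄, e₃, e₅, e₆, e₇]

/-- A strong structure whose face translations act transitively is the nilparallelepiped structure
of the group of face translations. -/
theorem isNilparallelepiped_of_transitive (hS : S.IsStrong)
    (ht : ∀ a b : X, ∃ g ∈ S.faceTranslations, g a = b) : S.IsNilparallelepiped := by
  obtain ⟨e⟩ := S.nonempty
  let Γ := MulAction.stabilizer S.faceTranslations e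
  let φ : S.faceTranslations ⧸ Γ ≃ X :=
    Equiv.ofBijective (MulAction.ofQuotientStabilizer S.faceTranslations e)
      ⟨MulAction.injective_ofQuotientStabilizer _ e, fun b => by
        obtain ⟨g, hg, rfl⟩ := ht e b
        exact ⟨QuotientGroup.mk ⟨g, hg⟩, rfl⟩⟩
  have hφ : ∀ {k : ℕ} (A : Set (Cube k S.faceTranslations)) (x : Cube k X),
      φ.symm ∘ x ∈ Cube.proj Γ '' A ↔ ∃ γ ∈ A, ∀ ε, γ ε • e = x ε := by
    intro k A x
    refine exists_congr fun γ => and_congr_right fun _ => ?_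
    rw [funext_iff]
    refine forall_congr' fun ε => ?_
    exact Equiv.eq_symm_apply φ
  refine ⟨S.faceTranslations, inferInstance, S.centralSubgroup, Γ, φ.symm,
    commutator_le_centralSubgroup, centralSubgroup_le_center hS,
    stabilizer_inf_centralSubgroup hS e, fun x => ?_, fun x => ?_⟩
  · refine Iff.trans ⟨exists_nilP_of_mem_P hS ht e, ?_⟩ (hφ _ x).symm
    rintro ⟨γ, hγ, h⟩
    exact funext h ▸ apply_mem_P_of_mem_nilP hγ e
  · refine Iff.trans ⟨exists_nilQ_of_mem_Q hS ht e, ?_⟩ (hφ _ x).symm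
    rintro ⟨γ, hγ, h⟩
    exact funext h ▸ apply_mem_Q_of_mem_nilQ hγ e

end ParallelepipedStructure

theorem mainTheorem9 {X : Type u} (S : ParallelepipedStructure X) (hS : S.IsStrong)
    (h : Module.Injective ℤ (Additive S.FiberGroup) ∨ Module.Projective ℤ (Additive S.Base)) :
    S.IsNilparallelepiped :=
  S.isNilparallelepiped_of_transitive hS
    (ParallelepipedStructure.exists_faceTranslation_apply_eq hS h)
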